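/- Let $M$ be a smooth manifold of dimension $n\ge 1$. A Finsler metric on $M$ is a function $\tilde F$ on $TM$, smooth on $TM\setminus 0$, positive on nonzero vectors, with $\tilde F(x,cy)=c\,\tilde F(x,y)$ for $c>0$. It is strongly convex if $g_{ij}=\tfrac12(\tilde F^2)_{y^iy^j}$ is positive definite at every $(x,y)$ with $y\neq 0$. It is of Randers type if $\tilde F(x,y)=\sqrt{a_x(y,y)}+\beta_x(y)$ for a smooth Riemannian metric $a$ and a smooth $1$-form $\beta$ on $M$. It is Riemannian if $\tilde F(x,y)=\sqrt{g_x(y,y)}$ for a smooth Riemannian metric $g$. Navigation data consist of a smooth Riemannian metric $h$, a smooth vector field $W$ (the wind) and a smooth function $x\mapsto|u(x)|_h$ (the preassigned own speed of the ship), with $|W(x)|_h<|u(x)|_h\le 1$ for all $x\in M$. A trajectory is a piecewise $C^1$ path $\gamma:[0,T]\to M$, $T>0$, such that at all times $\dot\gamma=u+W(\gamma)$ for some $u\in T_{\gamma}M$ whose $h$-norm is the preassigned own speed at $\gamma$ (for one-sided derivatives at the break points and end points). It is time-optimal if no trajectory with the same initial and the same final point takes less time. The metric $\tilde F$ solves the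 generalized Zermelo navigation problem with data $(h,W,|u|_h)$ if * the $\tilde F$-length of every trajectory $\gamma:[0,T]\to M$ is its transit time $T$, and * the time-optimal trajectories are exactly the piecewise $C^1$ paths $\gamma:[0,T]\to M$ that have $\tilde F(\dot\gamma)=1$ and are of least $\tilde F$-length among all piecewise $C^1$ paths with nowhere vanishing (one-sided) velocity having the same initial and the same final point. Let $\tilde F$ be a strongly convex Finsler metric on $M$. Then: 1. $\tilde F$ is of Randers type if and only if it solves the generalized Zermelo navigation problem for some navigation data $(h,W,|u|_h)$ on $M$. Moreover, if $\tilde F$ is of Randers type, then for every smooth function $s:M\to(0,1]$ the data can be chosen with $|u(x)|_h=s(x)$ for all $x$. 2. Suppose that $\tilde F$ solves the generalized Zermelo navigation problem with data $(h,W,|u|_h)$. Then $\tilde F$ is Riemannian if and only if $W=0$; and $\tilde F$ is the norm of a Riemannian metric conformal to $h$, that is, $\tilde F(x,y)^2=\rho(x)\,h_x(y,y)$ for a smooth function $\rho>0$, if and only if $W=0$. Furthermore, $\tilde F(x,y)=c\,|y|_h$ for some constant $c>0$ if and only if $W=0$ and $h(u,u)=|u(x)|_h^2$ is constant on $M$.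 -/

import Mathlib

open Set Bundle
open scoped Manifold ContDiff

namespace ZermeloNavigation

/-- The model space `ℝⁿ` of an `n`-dimensional manifold. -/
abbrev Model (n : ℕ) : Type := EuclideanSpace ℝ (Fin n)

/-- The tangent space of an `n`-dimensional manifold at a point. -/
abbrev Tan (n : ℕ) {M : Type*} [TopologicalSpace M] [ChartedSpace (Model n) M] (x : M) : Type :=
  TangentSpace (𝓡 n) x

/-- Smooth Riemannian metrics on an `n`-dimensional manifold `M`. -/
abbrev RiemMetric (n : ℕ) (M : Type*) [TopologicalSpace M] [ChartedSpace (Model n) M]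
    [IsManifold (𝓡 n) ∞ M] :=
  ContMDiffRiemannianMetric (𝓡 n) ∞ (Model n) (fun x : M => TangentSpace (𝓡 n) x)

/-- A Finsler metric: a function on the tangent bundle that is smooth away from the zero section,
positive on nonzero vectors and positively homogeneous of degree one on every fibre. -/
structure FinslerMetric (n : ℕ) (M : Type*) [TopologicalSpace M] [ChartedSpace (Model n) M]
    [IsManifold (𝓡 n) ∞ M] where
  toFun (x : M) : Tan n x → ℝ
  contMDiffOn : ContMDiffOn (𝓡 n).tangent 𝓘(ℝ, ℝ) ∞
    (fun p : TangentBundle (𝓡 n) M => toFun p.1 p.2) {p | p.2 ≠ 0}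
  pos (x : M) (y : Tan n x) (hy : y ≠ 0) : 0 < toFun x y
  homogeneous (x : M) (c : ℝ) (hc : 0 < c) (y : Tan n x) : toFun x (c • y) = c * toFun x y

section

variable {n : ℕ} {M : Type*} [TopologicalSpace M] [ChartedSpace (Model n) M]

/-! ### Piecewise `C¹` paths -/

/-- `γ` restricted to `[a, b]`, `a < b`, is a piecewise `C¹` path all of whose velocities (at the
finitely many break points and at the end points: the one-sided velocities) satisfy `P`. -/
def IsPathWith (γ : ℝ → M) (a b : ℝ) (P : ∀ x : M, Tan n x → Prop) : Prop :=
  a < b ∧ ContinuousOn γ (Icc a b) ∧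
    ∃ S : Set ℝ, S.Finite ∧
      ∀ c d : ℝ, a ≤ c → c < d → d ≤ b → Disjoint (Ioo c d) S →
        ContMDiffOn 𝓘(ℝ, ℝ) (𝓡 n) 1 γ (Icc c d) ∧
          ∀ t ∈ Icc c d, P (γ t) (mfderivWithin 𝓘(ℝ, ℝ) (𝓡 n) γ (Icc c d) t (1 : ℝ))

/-- A regular piecewise `C¹` path: all (one-sided) velocities are nonzero. -/
def IsRegularPath (γ : ℝ → M) (a b : ℝ) : Prop :=
  IsPathWith (n := n) γ a b (fun _ v => v ≠ 0)

variable [IsManifold (𝓡 n) ∞ M]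

/-- The norm `|y|_h = √h(y, y)`. -/
noncomputable def hnorm (h : RiemMetric n M) (x : M) (y : Tan n x) : ℝ :=
  √(h.inner x y y)

/-! ### Finsler metrics -/

namespace FinslerMetric

/-- The fundamental tensor `g_y(v, w) = ½ ∂²F(x, y + s v + t w)² / ∂s ∂t` at `s = t = 0`, that is,
the bilinear form with components `½ (F²)_{yⁱ yʲ}`. -/
noncomputable def fundamentalTensor (F : FinslerMetric n M) (x : M) (y v w : Tan n x) : ℝ :=
  deriv (fun s : ℝ => deriv (fun t : ℝ => (F.toFun x (y + s • v + t • w)) ^ 2 / 2) 0) 0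

/-- Strong convexity: the fundamental tensor is positive definite at every nonzero vector. -/
def IsStronglyConvex (F : FinslerMetric n M) : Prop :=
  ∀ (x : M) (y : Tan n x), y ≠ 0 → ∀ v : Tan n x, v ≠ 0 → 0 < F.fundamentalTensor x y v v

/-- `F = α + β` with `α` the norm of a Riemannian metric and `β` a smooth one-form. -/
def IsRanders (F : FinslerMetric n M) : Prop :=
  ∃ (a : RiemMetric n M) (β : ∀ x : M, Tan n x →L[ℝ] ℝ),
    ContMDiff (𝓡 n) ((𝓡 n).prod 𝓘(ℝ, Model n →L[ℝ] ℝ)) ∞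
      (fun x => TotalSpace.mk' (Model n →L[ℝ] ℝ)
        (E := fun x : M => TangentSpace (𝓡 n) x →L[ℝ] Bundle.Trivial M ℝ x) x (β x)) ∧
    ∀ (x : M) (y : Tan n x), F.toFun x y = hnorm a x y + β x y

/-- `F` is the norm of some Riemannian metric. -/
def IsRiemannian (F : FinslerMetric n M) : Prop :=
  ∃ g : RiemMetric n M, ∀ (x : M) (y : Tan n x), F.toFun x y = hnorm g x y

/-- `F` is the norm of a Riemannian metric conformal to `h`: `F² = ρ h` for a smooth positive
function `ρ`. -/
def IsConformalTo (F : FinslerMetric n M) (h : RiemMetric n M) : Prop :=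
  ∃ ρ : M → ℝ, ContMDiff (𝓡 n) 𝓘(ℝ, ℝ) ∞ ρ ∧ (∀ x, 0 < ρ x) ∧
    ∀ (x : M) (y : Tan n x), (F.toFun x y) ^ 2 = ρ x * h.inner x y y

/-- `F` is the norm of `h` up to a constant positive factor. -/
def IsScalingOf (F : FinslerMetric n M) (h : RiemMetric n M) : Prop :=
  ∃ c : ℝ, 0 < c ∧ ∀ (x : M) (y : Tan n x), F.toFun x y = c * hnorm h x y

/-- The `F`-length of `γ` on `[a, b]`. -/
noncomputable def length (F : FinslerMetric n M) (γ : ℝ → M) (a b : ℝ) : ℝ :=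
  ∫ t in a..b, F.toFun (γ t) (mfderiv 𝓘(ℝ, ℝ) (𝓡 n) γ t (1 : ℝ))

/-- `γ` on `[a, b]` is a regular path of least `F`-length among the regular paths with the same
initial and the same final point. -/
def IsShortest (F : FinslerMetric n M) (γ : ℝ → M) (a b : ℝ) : Prop :=
  IsRegularPath (n := n) γ a b ∧
    ∀ (σ : ℝ → M) (c d : ℝ), IsRegularPath (n := n) σ c d → σ c = γ a → σ d = γ b →
      F.length γ a b ≤ F.length σ c d

/-- `γ` on `[a, b]` is a path with `F`-speed one. -/
def IsUnitSpeed (F : FinslerMetric n M) (γ : ℝ → M) (a b : ℝ) : Prop :=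
  IsPathWith (n := n) γ a b (fun x v => F.toFun x v = 1)

end FinslerMetric

end

/-! ### The generalized Zermelo navigation problem -/

/-- The data of the navigation problem: a background Riemannian metric `h`, a wind `W` and the
preassigned own speed `speed x = |u(x)|_h` of the ship, subject to `|W|_h < |u|_h ≤ 1`. -/
structure NavigationData (n : ℕ) (M : Type*) [TopologicalSpace M] [ChartedSpace (Model n) M]
    [IsManifold (𝓡 n) ∞ M] where
  h : RiemMetric n M
  W (x : M) : Tan n x
  contMDiff_W : ContMDiff (𝓡 n) (𝓡 n).tangent ∞ (fun x => (⟨x, W x⟩ : TangentBundle (𝓡 n) M))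
  speed : M → ℝ
  contMDiff_speed : ContMDiff (𝓡 n) 𝓘(ℝ, ℝ) ∞ speed
  speed_le_one (x : M) : speed x ≤ 1
  wind_lt_speed (x : M) : hnorm h x (W x) < speed x

section

variable {n : ℕ} {M : Type*} [TopologicalSpace M] [ChartedSpace (Model n) M]
  [IsManifold (𝓡 n) ∞ M]

namespace NavigationData

/-- `γ`, parametrized by the time `t ∈ [0, T]`, is a trajectory of the ship: at every moment its
velocity is the sum `u + W` of an own velocity `u` with the preassigned speed and of the wind. -/
def IsTrajectory (D : NavigationData n M) (γ : ℝ → M) (T : ℝ) : Prop :=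
  IsPathWith (n := n) γ 0 T
    (fun x v => ∃ u : Tan n x, hnorm D.h x u = D.speed x ∧ v = u + D.W x)

/-- `γ` is a time-optimal trajectory: no trajectory with the same initial and the same final point
takes less time. -/
def IsTimeOptimal (D : NavigationData n M) (γ : ℝ → M) (T : ℝ) : Prop :=
  D.IsTrajectory γ T ∧
    ∀ (σ : ℝ → M) (T' : ℝ), D.IsTrajectory σ T' → σ 0 = γ 0 → σ T' = γ T → T ≤ T'

end NavigationData

/-- The Finsler metric `F` solves the navigation problem with data `D`: the `F`-length of every
trajectory is its transit time, and the time-optimal trajectories are exactly the shortest paths of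
`F`, run through with `F`-speed one. -/
structure FinslerMetric.Solves (F : FinslerMetric n M) (D : NavigationData n M) : Prop where
  transit_time (γ : ℝ → M) (T : ℝ) : D.IsTrajectory γ T → F.length γ 0 T = T
  timeOptimal_iff (γ : ℝ → M) (T : ℝ) :
    D.IsTimeOptimal γ T ↔ F.IsUnitSpeed γ 0 T ∧ F.IsShortest γ 0 T

end

end ZermeloNavigation

/-! A positively homogeneous norm is determined by its indicatrix, so everything reduces to
comparing indicatrices. The velocities available to the ship at `x` form the `h`-sphere of radius
`|u|` about `W`; as `|W| < |u|`, this sphere encloses the origin, and solving the quadratic equation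
for the norm with this unit sphere yields the Randers norm of
`NavigationData.randersNorm_eq_one_iff`. Conversely, the indicatrix of `α + β` is an ellipsoid,
whose centre is `W` and whose quadratic form is `h`; multiplying `h` by `s²` turns own speed one
into `s` without moving the ellipsoid (`FinslerMetric.IsRanders.exists_navigationData`).

If the indicatrices of `F` are these spheres, trajectories are the unit-speed paths, and each
regular path can be run at unit speed in a time equal to its length; hence least time and least
length agree (`FinslerMetric.solves_of_indicatrix`). In the other direction transit times determine
`F`: a trajectory can start in any direction, and differentiating "length = time" along its initial
segments gives `F = 1` on its initial velocity (`FinslerMetric.Solves.eq_randersNorm`).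

The Riemannian, conformal and scaled cases all make `F` reversible, which forces `W = 0`; without
wind, `F` is `|y|_h / |u|`. -/

namespace ZermeloNavigation

/-! ### Linear algebra in a fibre -/

section LinearAlgebra

variable {V : Type*} [NormedAddCommGroup V] [NormedSpace ℝ V]

theorem contDiff_tensorSquare : ContDiff ℝ ∞ (fun l : V →L[ℝ] ℝ => l.smulRight l) :=
  ContDiff.smulRight (f := id) (g := id) contDiff_id contDiff_id

/-- Injectivity suffices because a finite-dimensional space and its dual have equal dimension. It is
applied to metrics, pointwise and in coordinates, to raise indices. -/
theorem isInvertible_of_forall_ne_zero [FiniteDimensional ℝ V] {A : V →L[ℝ] V →L[ℝ] ℝ}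
    (hA : ∀ v, v ≠ 0 → A v ≠ 0) : A.IsInvertible := by
  have hinj : Function.Injective (A : V →ₗ[ℝ] V →L[ℝ] ℝ) := by
    rw [injective_iff_map_eq_zero]
    intro v hv
    by_contra h
    exact hA v h hv
  have hdim : Module.finrank ℝ V = Module.finrank ℝ (V →L[ℝ] ℝ) := by
    rw [← (LinearMap.toContinuousLinearMap : (V →ₗ[ℝ] ℝ) ≃ₗ[ℝ] _).finrank_eq]
    exact (Subspace.dual_finrank_eq (K := ℝ) (V := V)).symm
  refine ⟨(LinearEquiv.ofInjectiveOfFinrankEq (A : V →ₗ[ℝ] V →L[ℝ] ℝ) hinj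
    hdim).toContinuousLinearEquiv, ?_⟩
  ext v w
  rfl

end LinearAlgebra

/-! ### Smoothness of one-forms, bilinear forms and vector fields -/

section BundleAlgebra

variable {n : ℕ} {M : Type*} [TopologicalSpace M] [ChartedSpace (Model n) M]
  [IsManifold (𝓡 n) ∞ M]

/-- Smoothness of a one-form. -/
def IsSmoothForm (β : ∀ x : M, Tan n x →L[ℝ] ℝ) : Prop :=
  ContMDiff (𝓡 n) ((𝓡 n).prod 𝓘(ℝ, Model n →L[ℝ] ℝ)) ∞
    (fun x => TotalSpace.mk' (Model n →L[ℝ] ℝ)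
      (E := fun x : M => TangentSpace (𝓡 n) x →L[ℝ] Bundle.Trivial M ℝ x) x (β x))

/-- Smoothness of a field of bilinear forms. -/
def IsSmoothBilin (g : ∀ x : M, Tan n x →L[ℝ] Tan n x →L[ℝ] ℝ) : Prop :=
  ContMDiff (𝓡 n) ((𝓡 n).prod 𝓘(ℝ, Model n →L[ℝ] Model n →L[ℝ] ℝ)) ∞
    (fun x => TotalSpace.mk' (Model n →L[ℝ] Model n →L[ℝ] ℝ)
      (E := fun x : M => TangentSpace (𝓡 n) x →L[ℝ] TangentSpace (𝓡 n) x →L[ℝ]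
        Bundle.Trivial M ℝ x) x (g x))

theorem RiemMetric.isSmoothBilin (g : RiemMetric n M) : IsSmoothBilin g.inner := g.contMDiff

theorem IsSmoothBilin.flat {g : ∀ x : M, Tan n x →L[ℝ] Tan n x →L[ℝ] ℝ} (hg : IsSmoothBilin g)
    {W : ∀ x : M, Tan n x}
    (hW : ContMDiff (𝓡 n) (𝓡 n).tangent ∞ (fun x => (⟨x, W x⟩ : TangentBundle (𝓡 n) M))) :
    IsSmoothForm (fun x => g x (W x)) :=
  ContMDiff.clm_bundle_apply (E₁ := fun x : M => TangentSpace (𝓡 n) x)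
    (E₂ := fun x : M => TangentSpace (𝓡 n) x →L[ℝ] Bundle.Trivial M ℝ x) (b := id) hg hW

theorem IsSmoothForm.apply {β : ∀ x : M, Tan n x →L[ℝ] ℝ} (hβ : IsSmoothForm β)
    {W : ∀ x : M, Tan n x}
    (hW : ContMDiff (𝓡 n) (𝓡 n).tangent ∞ (fun x => (⟨x, W x⟩ : TangentBundle (𝓡 n) M))) :
    ContMDiff (𝓡 n) 𝓘(ℝ, ℝ) ∞ (fun x => β x (W x)) := by
  have h : ContMDiff (𝓡 n) ((𝓡 n).prod 𝓘(ℝ, ℝ)) ∞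
      (fun x => TotalSpace.mk' ℝ (E := Bundle.Trivial M ℝ) x (β x (W x))) :=
    ContMDiff.clm_bundle_apply (E₁ := fun x : M => TangentSpace (𝓡 n) x)
      (E₂ := Bundle.Trivial M ℝ) (b := id) hβ hW
  intro x
  have := h x
  simp only [contMDiffAt_totalSpace] at this
  exact this.2

theorem IsSmoothForm.continuous {β : ∀ x : M, Tan n x →L[ℝ] ℝ} (hβ : IsSmoothForm β) :
    Continuous (fun p : TangentBundle (𝓡 n) M => β p.1 p.2) := by
  have h : Continuous
      (fun p : TangentBundle (𝓡 n) M =>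
        TotalSpace.mk' ℝ (E := Bundle.Trivial M ℝ) p.1 (β p.1 p.2)) :=
    Continuous.clm_bundle_apply (E₁ := fun x : M => TangentSpace (𝓡 n) x) (F₁ := Model n)
      (E₂ := Bundle.Trivial M ℝ) (b := fun p : TangentBundle (𝓡 n) M => p.1)
      ((ContMDiff.continuous hβ).comp (FiberBundle.continuous_proj _ _)) continuous_id
  rw [continuous_iff_continuousAt] at h ⊢
  intro x
  have := h x
  simp only [FiberBundle.continuousAt_totalSpace] at this
  exact this.2

theorem IsSmoothBilin.continuous {g : ∀ x : M, Tan n x →L[ℝ] Tan n x →L[ℝ] ℝ}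
    (hg : IsSmoothBilin g) :
    Continuous (fun p : TangentBundle (𝓡 n) M => g p.1 p.2 p.2) := by
  have h : Continuous
      (fun p : TangentBundle (𝓡 n) M =>
        TotalSpace.mk' ℝ (E := Bundle.Trivial M ℝ) p.1 (g p.1 p.2 p.2)) :=
    Continuous.clm_bundle_apply₂ (E₁ := fun x : M => TangentSpace (𝓡 n) x) (F₁ := Model n)
      (E₂ := fun x : M => TangentSpace (𝓡 n) x) (F₂ := Model n)
      (E₃ := Bundle.Trivial M ℝ) (b := fun p : TangentBundle (𝓡 n) M => p.1)
      ((ContMDiff.continuous hg).comp (FiberBundle.continuous_proj _ _)) continuous_id continuous_id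
  rw [continuous_iff_continuousAt] at h ⊢
  intro x
  have := h x
  simp only [FiberBundle.continuousAt_totalSpace] at this
  exact this.2

theorem IsSmoothForm.smul {β : ∀ x : M, Tan n x →L[ℝ] ℝ} (hβ : IsSmoothForm β) {p : M → ℝ}
    (hp : ContMDiff (𝓡 n) 𝓘(ℝ, ℝ) ∞ p) : IsSmoothForm (fun x => p x • β x) :=
  ContMDiff.smul_section (V := fun x : M => TangentSpace (𝓡 n) x →L[ℝ] Bundle.Trivial M ℝ x)
    hp hβ

set_option synthInstance.maxHeartbeats 400000 in
theorem IsSmoothBilin.smul {g : ∀ x : M, Tan n x →L[ℝ] Tan n x →L[ℝ] ℝ} (hg : IsSmoothBilin g)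
    {p : M → ℝ} (hp : ContMDiff (𝓡 n) 𝓘(ℝ, ℝ) ∞ p) : IsSmoothBilin (fun x => p x • g x) :=
  ContMDiff.smul_section (V := fun x : M => TangentSpace (𝓡 n) x →L[ℝ]
    TangentSpace (𝓡 n) x →L[ℝ] Bundle.Trivial M ℝ x) hp hg

set_option synthInstance.maxHeartbeats 400000 in
theorem IsSmoothBilin.add {g k : ∀ x : M, Tan n x →L[ℝ] Tan n x →L[ℝ] ℝ} (hg : IsSmoothBilin g)
    (hk : IsSmoothBilin k) : IsSmoothBilin (fun x => g x + k x) :=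
  ContMDiff.add_section (V := fun x : M => TangentSpace (𝓡 n) x →L[ℝ]
    TangentSpace (𝓡 n) x →L[ℝ] Bundle.Trivial M ℝ x) hg hk

set_option synthInstance.maxHeartbeats 400000 in
/-- The square `β ⊗ β` of a smooth one-form is smooth. -/
theorem IsSmoothForm.tensorSquare {β : ∀ x : M, Tan n x →L[ℝ] ℝ} (hβ : IsSmoothForm β) :
    IsSmoothBilin (fun x => (β x).smulRight (β x)) := by
  intro x₀
  have h := hβ x₀
  rw [contMDiffAt_hom_bundle] at h ⊢
  refine ⟨contMDiffAt_id, ?_⟩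
  have h2 := h.2
  -- In the trivialization at `x₀` the field is the fixed smooth map `l ↦ l ⊗ l` applied to the
  -- coordinate covector of `β`.
  have h3 := (contDiff_tensorSquare (V := Model n)).contMDiff.contMDiffAt.comp x₀ h2
  refine h3.congr_of_eventuallyEq ?_
  filter_upwards [(trivializationAt (Model n) (fun x : M => TangentSpace (𝓡 n) x)
    x₀).open_baseSet.mem_nhds (FiberBundle.mem_baseSet_trivializationAt' x₀)] with x hx
  ext v w
  rw [inCoordinates_apply_eq₂ hx hx (by simp)]
  simp [ContinuousLinearMap.inCoordinates, Trivialization.symmL_apply _ hx]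

/-- A vector field whose dual form with respect to a metric is smooth is smooth. -/
theorem contMDiff_of_flat {g : RiemMetric n M} {V : ∀ x : M, Tan n x}
    (hV : IsSmoothForm (fun x => g.inner x (V x))) :
    ContMDiff (𝓡 n) (𝓡 n).tangent ∞ (fun x => (⟨x, V x⟩ : TangentBundle (𝓡 n) M)) := by
  intro x₀
  have hg := g.isSmoothBilin x₀
  have h := hV x₀
  rw [contMDiffAt_hom_bundle] at h hg
  rw [contMDiffAt_totalSpace]
  refine ⟨contMDiffAt_id, ?_⟩
  set e := trivializationAt (Model n) (fun x : M => TangentSpace (𝓡 n) x) x₀ with he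
  have hbase := FiberBundle.mem_baseSet_trivializationAt' (F := Model n)
    (E := fun x : M => TangentSpace (𝓡 n) x) x₀
  have hA (x : M) (hx : x ∈ e.baseSet) : ContinuousLinearMap.IsInvertible
      (ContinuousLinearMap.inCoordinates (Model n) (fun x : M => TangentSpace (𝓡 n) x)
        (Model n →L[ℝ] ℝ) (fun b : M => TangentSpace (𝓡 n) b →L[ℝ] Bundle.Trivial M ℝ b)
        x₀ x x₀ x (g.inner x)) := by
    apply isInvertible_of_forall_ne_zero
    intro v hv h0
    have h1 := DFunLike.congr_fun h0 v
    rw [inCoordinates_apply_eq₂ hx hx (by simp)] at h1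
    have h2 : e.symm x v ≠ 0 := by
      intro h3
      apply hv
      apply (e.continuousLinearEquivAt ℝ x hx).symm.injective
      rw [map_zero]
      exact h3
    refine (g.pos x _ h2).ne' ?_
    simpa using h1
  -- The coordinates of `V` are the inverse of the coordinate form of `g` applied to the covector,
  -- and inversion is smooth at invertible maps.
  have hc := (((hA x₀ hbase).contDiffAt_map_inverse (n := ∞)).contMDiffAt.comp
    x₀ hg.2).clm_apply h.2
  refine hc.congr_of_eventuallyEq ?_
  filter_upwards [e.open_baseSet.mem_nhds hbase] with x hx
  obtain ⟨A, hA'⟩ := hA x hx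
  simp only [Function.comp_apply]
  rw [← hA', ContinuousLinearMap.inverse_equiv, ContinuousLinearEquiv.coe_coe,
    ContinuousLinearEquiv.eq_symm_apply, ← ContinuousLinearEquiv.coe_coe, hA']
  ext w
  rw [inCoordinates_apply_eq₂ hx hx (by simp)]
  have hsymm : e.symm x (e ⟨x, V x⟩).2 = V x := by
    have := e.symm_apply_apply_mk hx (V x)
    simpa using this
  rw [hsymm]
  simp [ContinuousLinearMap.inCoordinates, Trivialization.symmL_apply _ hx, ← he]

end BundleAlgebra

/-- Squaring adds only the branch `√A = B - 1`, which `B ≤ √A` excludes. Thus the indicatrix of a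
Randers norm is a full quadric. -/
theorem sqrt_add_eq_one_iff {A B : ℝ} (h : B ^ 2 ≤ A) : √A + B = 1 ↔ A = (1 - B) ^ 2 := by
  have hA : 0 ≤ A := (sq_nonneg B).trans h
  have hB : |B| ≤ √A := Real.abs_le_sqrt h
  have hB' := (le_abs_self B).trans hB
  constructor
  · intro h1
    rw [← Real.sq_sqrt hA]
    congr 1
    linarith
  · intro h1
    have h2 : √A ^ 2 = (1 - B) ^ 2 := by rw [Real.sq_sqrt hA, h1]
    rcases sq_eq_sq_iff_eq_or_eq_neg.mp h2 with h3 | h3 <;> linarith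

/-- With `b = |β|²_a`, this computes `|W|²_h / s² = b` for the wind and metric recovered from a
Randers norm. -/
theorem norm_wind_identity {b : ℝ} (hb : 1 - b ≠ 0) :
    (1 - b) * (-(1 - b)⁻¹ * (-(1 - b)⁻¹ * b) - (-(1 - b)⁻¹ * b) ^ 2) = b := by
  field_simp

/-! ### Riemannian metrics perturbed by a one-form -/

section Metrics

variable {n : ℕ} {M : Type*} [TopologicalSpace M] [ChartedSpace (Model n) M]
  [IsManifold (𝓡 n) ∞ M]

/-- The Riemannian metric `p a + q β ⊗ β`, bounded below by `c a`. -/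
noncomputable def RiemMetric.perturb (a : RiemMetric n M) {β : ∀ x : M, Tan n x →L[ℝ] ℝ}
    (hβ : IsSmoothForm β) {p q : M → ℝ} (hp : ContMDiff (𝓡 n) 𝓘(ℝ, ℝ) ∞ p)
    (hq : ContMDiff (𝓡 n) 𝓘(ℝ, ℝ) ∞ q) (c : M → ℝ) (hc : ∀ x, 0 < c x)
    (hle : ∀ x v, c x * a.inner x v v ≤ p x * a.inner x v v + q x * β x v ^ 2) :
    RiemMetric n M where
  inner x := p x • a.inner x + q x • (β x).smulRight (β x)
  symm x v w := by
    simp [a.symm x v w, mul_comm (β x v)]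
  pos x v hv := by
    have := (mul_pos (hc x) (a.pos x v hv)).trans_le (hle x v)
    simpa [sq] using this
  isVonNBounded x := by
    -- By the lower bound, the new unit ball lies in the unit ball of `a` scaled by `c^(-1/2)`.
    have h := (a.isVonNBounded x).image ((√(c x))⁻¹ • ContinuousLinearMap.id ℝ (Tan n x))
    refine h.subset ?_
    intro v hv
    refine ⟨√(c x) • v, ?_, ?_⟩
    · have h1 : c x * a.inner x v v < 1 := by
        refine (hle x v).trans_lt ?_
        simpa [sq] using hv
      simpa [← mul_assoc, Real.mul_self_sqrt (hc x).le] using h1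
    · have := (Real.sqrt_pos.mpr (hc x)).ne'
      simp [smul_smul, this]
  contMDiff := (a.isSmoothBilin.smul hp).add (hβ.tensorSquare.smul hq)

theorem RiemMetric.perturb_inner (a : RiemMetric n M) {β : ∀ x : M, Tan n x →L[ℝ] ℝ}
    (hβ : IsSmoothForm β) {p q : M → ℝ} (hp : ContMDiff (𝓡 n) 𝓘(ℝ, ℝ) ∞ p)
    (hq : ContMDiff (𝓡 n) 𝓘(ℝ, ℝ) ∞ q) (c : M → ℝ) (hc : ∀ x, 0 < c x)
    (hle : ∀ x v, c x * a.inner x v v ≤ p x * a.inner x v v + q x * β x v ^ 2)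
    (x : M) (v w : Tan n x) : (a.perturb hβ hp hq c hc hle).inner x v w =
      p x * a.inner x v w + q x * (β x v * β x w) := by
  simp [RiemMetric.perturb]

theorem RiemMetric.inner_self_nonneg (a : RiemMetric n M) (x : M) (v : Tan n x) :
    0 ≤ a.inner x v v := by
  by_cases hv : v = 0
  · simp [hv]
  · exact (a.pos x v hv).le

theorem RiemMetric.inner_sq_le (a : RiemMetric n M) (x : M) (v w : Tan n x) :
    a.inner x v w ^ 2 ≤ a.inner x v v * a.inner x w w := by
  by_cases hv : v = 0
  · simp [hv]
  have hpos := a.pos x v hv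
  -- Cauchy–Schwarz: up to the factor `|v|²`, this is the component of `w` orthogonal to `v`.
  have h := a.inner_self_nonneg x (a.inner x v v • w - a.inner x v w • v)
  simp only [map_sub, map_smul, sub_apply, smul_apply,
    smul_eq_mul, a.symm x w v] at h
  have h2 : 0 ≤ a.inner x v v * (a.inner x v v * a.inner x w w - a.inner x v w ^ 2) := by
    linarith
  linarith [nonneg_of_mul_nonneg_right h2 hpos]

theorem hnorm_eq_iff (h : RiemMetric n M) {x : M} {v : Tan n x} {r : ℝ} (hr : 0 ≤ r) :
    hnorm h x v = r ↔ h.inner x v v = r ^ 2 :=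
  Real.sqrt_eq_iff_eq_sq (h.inner_self_nonneg x v) hr

theorem hnorm_smul (h : RiemMetric n M) (x : M) {c : ℝ} (hc : 0 ≤ c) (v : Tan n x) :
    hnorm h x (c • v) = c * hnorm h x v := by
  simp [hnorm, ← mul_assoc, Real.sqrt_mul (mul_self_nonneg c), Real.sqrt_mul_self hc]

theorem hnorm_pos (h : RiemMetric n M) (x : M) {v : Tan n x} (hv : v ≠ 0) : 0 < hnorm h x v :=
  Real.sqrt_pos.mpr (h.pos x v hv)

/-- The vector field dual to a smooth one-form. -/
theorem exists_sharp (a : RiemMetric n M) {β : ∀ x : M, Tan n x →L[ℝ] ℝ} (hβ : IsSmoothForm β) :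
    ∃ V : ∀ x : M, Tan n x,
      ContMDiff (𝓡 n) (𝓡 n).tangent ∞ (fun x => (⟨x, V x⟩ : TangentBundle (𝓡 n) M)) ∧
      ∀ x w, a.inner x (V x) w = β x w := by
  have hex (x : M) : ∃ v : Tan n x, a.inner x v = β x := by
    have hinv := isInvertible_of_forall_ne_zero (V := Model n) (A := a.inner x) (by
      intro v hv h0
      have := a.pos x v hv
      rw [show a.inner x v = 0 from h0] at this
      exact lt_irrefl _ this)
    obtain ⟨A, hA⟩ := hinv
    refine ⟨A.symm (β x), ?_⟩
    have := A.apply_symm_apply (β x)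
    rw [← ContinuousLinearEquiv.coe_coe, hA] at this
    exact this
  choose V hV using hex
  refine ⟨V, contMDiff_of_flat (g := a) ?_, fun x w => by rw [hV]⟩
  simpa only [hV] using hβ

/-! ### From navigation data to a Randers norm -/

namespace NavigationData

variable (D : NavigationData n M)

/-- The own velocities composed with the wind: the velocities of trajectories. -/
def IsVelocity (x : M) (v : Tan n x) : Prop :=
  ∃ u : Tan n x, hnorm D.h x u = D.speed x ∧ v = u + D.W x

theorem speed_pos (x : M) : 0 < D.speed x :=
  (Real.sqrt_nonneg _).trans_lt (D.wind_lt_speed x)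

theorem isVelocity_iff (x : M) (v : Tan n x) :
    D.IsVelocity x v ↔ D.h.inner x (v - D.W x) (v - D.W x) = D.speed x ^ 2 := by
  rw [← hnorm_eq_iff _ (D.speed_pos x).le]
  constructor
  · rintro ⟨u, hu, rfl⟩
    simpa using hu
  · exact fun h => ⟨v - D.W x, h, by simp⟩

/-- `λ = |u|² - |W|²`. -/
noncomputable def gap (x : M) : ℝ := D.speed x ^ 2 - D.h.inner x (D.W x) (D.W x)

theorem gap_pos (x : M) : 0 < D.gap x := by
  have h := D.wind_lt_speed x
  rw [hnorm, Real.sqrt_lt' (D.speed_pos x)] at h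
  exact sub_pos.mpr h

theorem isSmoothForm_flat : IsSmoothForm (fun x => D.h.inner x (D.W x)) :=
  D.h.isSmoothBilin.flat D.contMDiff_W

theorem contMDiff_gap : ContMDiff (𝓡 n) 𝓘(ℝ, ℝ) ∞ D.gap :=
  (D.contMDiff_speed.pow 2).sub (D.isSmoothForm_flat.apply D.contMDiff_W)

theorem contMDiff_inv_gap : ContMDiff (𝓡 n) 𝓘(ℝ, ℝ) ∞ (fun x => (D.gap x)⁻¹) :=
  D.contMDiff_gap.inv₀ fun x => (D.gap_pos x).ne'

/-- The Riemannian part of the Randers norm attached to navigation data. -/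
noncomputable def randersMetric : RiemMetric n M :=
  D.h.perturb D.isSmoothForm_flat D.contMDiff_inv_gap (D.contMDiff_inv_gap.pow 2)
    (fun x => (D.gap x)⁻¹) (fun x => inv_pos.mpr (D.gap_pos x))
    (fun x v => le_add_of_nonneg_right (by positivity))

/-- The one-form of the Randers norm attached to navigation data. -/
noncomputable def randersForm (x : M) : Tan n x →L[ℝ] ℝ :=
  (-(D.gap x)⁻¹) • D.h.inner x (D.W x)

/-- The Randers norm attached to navigation data. -/
noncomputable def randersNorm (x : M) (v : Tan n x) : ℝ :=
  hnorm D.randersMetric x v + D.randersForm x v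

theorem isSmoothForm_randersForm : IsSmoothForm D.randersForm :=
  D.isSmoothForm_flat.smul (p := fun x => -(D.gap x)⁻¹) D.contMDiff_inv_gap.neg

theorem randersMetric_inner_self (x : M) (v : Tan n x) : D.randersMetric.inner x v v =
    (D.gap x)⁻¹ * D.h.inner x v v + ((D.gap x)⁻¹ * D.h.inner x (D.W x) v) ^ 2 := by
  rw [randersMetric, RiemMetric.perturb_inner]
  ring

theorem randersForm_apply (x : M) (v : Tan n x) :
    D.randersForm x v = -((D.gap x)⁻¹ * D.h.inner x (D.W x) v) := by
  simp [randersForm]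

/-- After squaring, the terms `(h(W,v)/λ)²` cancel and there remains `|v|² - 2h(W,v) = λ = |u|² -
|W|²`, that is, `|v - W|² = |u|²`. -/
theorem randersNorm_eq_one_iff (x : M) (v : Tan n x) :
    D.randersNorm x v = 1 ↔ D.IsVelocity x v := by
  have hg := D.gap_pos x
  have h0 : 0 ≤ (D.gap x)⁻¹ * D.h.inner x v v :=
    mul_nonneg (inv_pos.mpr hg).le (D.h.inner_self_nonneg x v)
  rw [randersNorm, hnorm, sqrt_add_eq_one_iff, isVelocity_iff, randersMetric_inner_self,
    randersForm_apply]
  · simp only [map_sub, sub_apply, D.h.symm x v (D.W x)]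
    have hgap : D.speed x ^ 2 = D.gap x + D.h.inner x (D.W x) (D.W x) := by simp [gap]
    rw [hgap]
    generalize D.h.inner x (D.W x) v = b
    generalize D.h.inner x v v = H
    generalize D.h.inner x (D.W x) (D.W x) = w
    have hg' := hg.ne'
    constructor
    · intro h
      field_simp at h
      nlinarith
    · intro h
      field_simp
      nlinarith
  · rw [randersMetric_inner_self, randersForm_apply]
    linarith

theorem randersNorm_pos (x : M) {v : Tan n x} (hv : v ≠ 0) : 0 < D.randersNorm x v := by
  have hg := inv_pos.mpr (D.gap_pos x)
  have h0 : 0 < (D.gap x)⁻¹ * D.h.inner x v v := mul_pos hg (D.h.pos x v hv)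
  rw [randersNorm, hnorm, randersMetric_inner_self, randersForm_apply]
  have := Real.lt_sqrt_of_sq_lt (lt_add_of_pos_left (((D.gap x)⁻¹ * D.h.inner x (D.W x) v) ^ 2) h0)
  linarith

theorem randersNorm_smul (x : M) {c : ℝ} (hc : 0 ≤ c) (v : Tan n x) :
    D.randersNorm x (c • v) = c * D.randersNorm x v := by
  simp only [randersNorm, hnorm_smul _ _ hc, map_smul, smul_eq_mul, mul_add]

theorem continuous_randersNorm :
    Continuous (fun p : TangentBundle (𝓡 n) M => D.randersNorm p.1 p.2) :=
  D.randersMetric.isSmoothBilin.continuous.sqrt.add D.isSmoothForm_randersForm.continuous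

end NavigationData

/-! ### From Randers norms to navigation data -/

/-- Completing the square in `a(v,v) = (1 - β(v))²` gives the data: with `V` dual to `β` and `b =
β(V) = |β|²_a`, take `W = -V/(1 - b)` and `h = s²(1 - b)(a - β ⊗ β)`. -/
theorem FinslerMetric.IsRanders.exists_navigationData {F : FinslerMetric n M} (hF : F.IsRanders)
    {s : M → ℝ} (hs : ContMDiff (𝓡 n) 𝓘(ℝ, ℝ) ∞ s) (hs' : ∀ x, 0 < s x ∧ s x ≤ 1) :
    ∃ D : NavigationData n M, D.speed = s ∧
      ∀ (x : M) (v : Tan n x), F.toFun x v = 1 ↔ D.IsVelocity x v := by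
  obtain ⟨a, β, hβ, hFa⟩ := hF
  change IsSmoothForm β at hβ
  obtain ⟨V, hV, haV⟩ := exists_sharp a hβ
  have hb : ContMDiff (𝓡 n) 𝓘(ℝ, ℝ) ∞ (fun x => β x (V x)) := hβ.apply hV
  have hb0 (x : M) : 0 ≤ β x (V x) := by
    rw [← haV]
    exact a.inner_self_nonneg x _
  have hb1 (x : M) : β x (V x) < 1 := by
    by_cases hVx : V x = 0
    · simp [hVx]
    -- Positivity in the worst direction `-V` reads `√b - b > 0`, which forces `b < 1`.
    have h1 := F.pos x (-V x) (neg_ne_zero.mpr hVx)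
    have h2 := a.pos x _ hVx
    simp only [hFa, hnorm, map_neg, neg_apply, neg_neg, haV] at h1 h2
    have h3 : β x (V x) < √(β x (V x)) := by linarith
    have h4 := Real.sq_sqrt (hb0 x)
    nlinarith
  have hβle (x : M) (v : Tan n x) : β x v ^ 2 ≤ β x (V x) * a.inner x v v := by
    rw [← haV x v, ← haV x (V x)]
    exact a.inner_sq_le x (V x) v
  have hβle' (x : M) (v : Tan n x) : β x v ^ 2 ≤ a.inner x v v :=
    (hβle x v).trans (mul_le_of_le_one_left (a.inner_self_nonneg x v) (hb1 x).le)
  have hε : ContMDiff (𝓡 n) 𝓘(ℝ, ℝ) ∞ (fun x => 1 - β x (V x)) := contMDiff_const.sub hb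
  have hε0 (x : M) : 0 < 1 - β x (V x) := sub_pos.mpr (hb1 x)
  have hp : ContMDiff (𝓡 n) 𝓘(ℝ, ℝ) ∞ (fun x => s x ^ 2 * (1 - β x (V x))) := (hs.pow 2).mul hε
  let h : RiemMetric n M := a.perturb hβ hp hp.neg
    -- The second factor `1 - b` comes from `a - β ⊗ β ≥ (1 - b) a`, by Cauchy–Schwarz.
    (fun x => s x ^ 2 * (1 - β x (V x)) * (1 - β x (V x)))
    (fun x => mul_pos (mul_pos (pow_pos (hs' x).1 2) (hε0 x)) (hε0 x)) (fun x v => by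
      have h1 := mul_pos (pow_pos (hs' x).1 2) (hε0 x)
      have := mul_le_mul_of_nonneg_left (hβle x v) h1.le
      linarith)
  have hh (x : M) (v : Tan n x) : h.inner x v v =
      s x ^ 2 * ((1 - β x (V x)) * (a.inner x v v - β x v ^ 2)) := by
    rw [RiemMetric.perturb_inner]
    ring
  have hW : ContMDiff (𝓡 n) (𝓡 n).tangent ∞
      (fun x => (⟨x, (-(1 - β x (V x))⁻¹) • V x⟩ : TangentBundle (𝓡 n) M)) :=
    ContMDiff.smul_section (V := fun x : M => TangentSpace (𝓡 n) x)
      (hε.inv₀ fun x => (hε0 x).ne').neg hV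
  refine ⟨⟨h, _, hW, s, hs, fun x => (hs' x).2, fun x => ?_⟩, rfl, fun x v => ?_⟩
  · rw [hnorm, Real.sqrt_lt' (hs' x).1, hh]
    apply mul_lt_of_lt_one_right (pow_pos (hs' x).1 2)
    simp only [map_smul, smul_apply, haV, smul_eq_mul]
    rw [norm_wind_identity (hε0 x).ne']
    exact hb1 x
  · rw [NavigationData.isVelocity_iff, hFa, hnorm, sqrt_add_eq_one_iff (hβle' x v)]
    dsimp only
    rw [hh]
    have hs2 := (pow_pos (hs' x).1 2).ne'
    rw [mul_eq_left₀ hs2]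
    simp only [map_sub, map_smul, smul_apply, sub_apply,
      a.symm x v, haV, smul_eq_mul]
    have := (hε0 x).ne'
    generalize β x (V x) = b at *
    generalize β x v = B
    generalize a.inner x v v = A
    -- The equations of the shifted sphere and of the Randers indicatrix differ only by the nonzero
    -- factor `1 - b`.
    have e : (1 - b) * (A - -(1 - b)⁻¹ * B - (-(1 - b)⁻¹ * (B - -(1 - b)⁻¹ * b)) -
        (B - -(1 - b)⁻¹ * b) ^ 2) - 1 = (1 - b) * (A - (1 - B) ^ 2) := by
      field_simp
      ring
    constructor
    · intro hA
      rw [← sub_eq_zero, e, hA, sub_self, mul_zero]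
    · intro hA
      rw [← sub_eq_zero, e] at hA
      exact sub_eq_zero.mp ((mul_eq_zero.mp hA).resolve_left this)

end Metrics

open MeasureTheory Filter Topology

/-! ### One-variable calculus for arc length -/

section Real

/-- A function that is interval integrable between consecutive points of a finite set is interval
integrable. -/
theorem intervalIntegrable_of_finite_breaks {f : ℝ → ℝ} {S : Set ℝ} (hS : S.Finite) :
    ∀ {a b : ℝ}, a ≤ b → (∀ c d, a ≤ c → c < d → d ≤ b → Disjoint (Ioo c d) S →
      IntervalIntegrable f volume c d) → IntervalIntegrable f volume a b := by
  induction S, hS using Set.Finite.induction_on with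
  | empty =>
    intro a b hab h
    rcases hab.eq_or_lt with rfl | hab
    · exact IntervalIntegrable.refl
    · exact h a b le_rfl hab le_rfl (disjoint_empty _)
  | @insert s S _ _ ih =>
    intro a b hab h
    by_cases hs : s ∈ Ioo a b
    · refine (ih hs.1.le fun c d hc hcd hd hdis => ?_).trans
        (ih hs.2.le fun c d hc hcd hd hdis => ?_)
      · refine h c d hc hcd (hd.trans hs.2.le) (disjoint_insert_right.mpr ⟨?_, hdis⟩)
        exact fun h' => (h'.2.trans_le hd).false
      · refine h c d (hs.1.le.trans hc) hcd hd (disjoint_insert_right.mpr ⟨?_, hdis⟩)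
        exact fun h' => (hc.trans_lt h'.1).false
    · refine ih hab fun c d hc hcd hd hdis => h c d hc hcd hd
        (disjoint_insert_right.mpr ⟨fun h' => hs ?_, hdis⟩)
      exact ⟨hc.trans_lt h'.1, h'.2.trans_le hd⟩

/-- The integral ignores the values of `f` at the end points, so `f` may be replaced by the
continuous extension of `g` by constants. This gives one-sided derivatives of arc length at break
points. -/
theorem hasDerivWithinAt_primitive {f g L : ℝ → ℝ} {a b : ℝ} (hab : a < b)
    (hL : ∀ t ∈ Icc a b, L t = L a + ∫ s in a..t, f s) (hg : ContinuousOn g (Icc a b))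
    (hfg : EqOn f g (Ioo a b)) {t : ℝ} (ht : t ∈ Icc a b) :
    HasDerivWithinAt L (g t) (Icc a b) t := by
  set G : ℝ → ℝ := IccExtend hab.le (fun s : Icc a b => g s) with hG
  have hGc : Continuous G := (continuousOn_iff_continuous_domRestrict.mp hg).Icc_extend'
  have hGg : EqOn G g (Icc a b) := fun s hs => IccExtend_of_mem hab.le _ hs
  have h1 : HasDerivAt (fun u => L a + ∫ s in a..u, G s) (G t) t :=
    (hGc.integral_hasStrictDerivAt a t).hasDerivAt.const_add _
  rw [hGg ht] at h1
  refine h1.hasDerivWithinAt.congr_of_mem (fun u hu => ?_) ht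
  rw [hL u hu]
  congr 1
  refine intervalIntegral.integral_congr_Ioo_of_le hu.1 fun s hs => ?_
  have hs' : s ∈ Ioo a b := ⟨hs.1, hs.2.trans_le hu.2⟩
  rw [hfg hs', hGg (Ioo_subset_Icc_self hs')]

theorem hasDerivWithinAt_of_leftInverse {L φ g : ℝ → ℝ} {a b c d : ℝ}
    (hφ : ContinuousOn φ (Icc c d)) (hmaps : MapsTo φ (Icc c d) (Icc a b))
    (hL : ∀ t ∈ Icc a b, HasDerivWithinAt L (g t) (Icc a b) t) (hg : ∀ t ∈ Icc a b, g t ≠ 0)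
    (hinv : ∀ τ ∈ Icc c d, L (φ τ) = τ) {τ : ℝ} (hτ : τ ∈ Icc c d) :
    HasDerivWithinAt φ (g (φ τ))⁻¹ (Icc c d) τ := by
  have h0 := hg _ (hmaps hτ)
  have h1 := (hL _ (hmaps hτ)).hasFDerivWithinAt.of_comp_of_leftInverse (g := φ) (s := Icc c d)
    (f'symm := .toSpanSingleton ℝ (g (φ τ))⁻¹)
    (tendsto_nhdsWithin_iff.mpr ⟨hφ τ hτ, eventually_nhdsWithin_of_forall hmaps⟩)
    (hasFDerivWithinAt_id τ _) (eventually_nhdsWithin_of_forall hinv)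
    (fun v => by simp [h0]) hτ
  simpa using h1.hasDerivWithinAt

theorem contDiffOn_of_leftInverse {L φ g : ℝ → ℝ} {a b c d : ℝ} (hcd : c < d)
    (hφ : ContinuousOn φ (Icc c d)) (hmaps : MapsTo φ (Icc c d) (Icc a b))
    (hL : ∀ t ∈ Icc a b, HasDerivWithinAt L (g t) (Icc a b) t) (hg : ∀ t ∈ Icc a b, g t ≠ 0)
    (hgc : ContinuousOn g (Icc a b))
    (hinv : ∀ τ ∈ Icc c d, L (φ τ) = τ) : ContDiffOn ℝ 1 φ (Icc c d) := by
  rw [contDiffOn_one_iff_derivWithin (uniqueDiffOn_Icc hcd)]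
  have h1 {τ : ℝ} (hτ : τ ∈ Icc c d) := hasDerivWithinAt_of_leftInverse hφ hmaps hL hg hinv hτ
  refine ⟨fun τ hτ => (h1 hτ).differentiableWithinAt, ?_⟩
  refine ((hgc.comp hφ hmaps).inv₀ fun τ hτ => hg _ (hmaps hτ)).congr fun τ hτ => ?_
  exact (h1 hτ).derivWithin (uniqueDiffOn_Icc hcd τ hτ)

/-- The right derivative of the integral at `0` is both `f 0` and `1`. This localizes "length =
time" to an initial velocity. -/
theorem eq_one_of_integral_eq {f : ℝ → ℝ} {T : ℝ} (hT : 0 < T) (hf : ContinuousOn f (Icc 0 T))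
    (h : ∀ τ, 0 < τ → τ ≤ T → ∫ t in (0 : ℝ)..τ, f t = τ) : f 0 = 1 := by
  have h0 : (0 : ℝ) ∈ Icc 0 T := left_mem_Icc.mpr hT.le
  have h1 : HasDerivWithinAt (fun t : ℝ => t) (f 0) (Icc 0 T) 0 := by
    refine hasDerivWithinAt_primitive (f := f) hT (fun t ht => ?_) hf (fun _ _ => rfl) h0
    rcases ht.1.eq_or_lt with rfl | ht0
    · simp
    · rw [h t ht0 ht.2, zero_add]
  exact (uniqueDiffOn_Icc hT 0 h0).eq_deriv _ h1 (hasDerivWithinAt_id _ _)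

end Real

/-! ### One-sided velocities of paths -/

section Velocity

variable {n : ℕ} {M : Type*} [TopologicalSpace M] [ChartedSpace (Model n) M]

/-- The velocity of a path defined on `[a, b]`, one-sided at the end points. -/
noncomputable def velocity (γ : ℝ → M) (a b t : ℝ) : Tan n (γ t) :=
  mfderivWithin 𝓘(ℝ, ℝ) (𝓡 n) γ (Icc a b) t (1 : ℝ)

theorem velocity_eq_mfderiv (γ : ℝ → M) {a b t : ℝ} (ht : t ∈ Ioo a b) :
    velocity (n := n) γ a b t = mfderiv 𝓘(ℝ, ℝ) (𝓡 n) γ t (1 : ℝ) := by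
  rw [velocity, mfderivWithin_of_mem_nhds (Icc_mem_nhds ht.1 ht.2)]

theorem uniqueMDiffOn_Icc_real {a b : ℝ} (hab : a < b) : UniqueMDiffOn 𝓘(ℝ, ℝ) (Icc a b) :=
  (uniqueDiffOn_Icc hab).uniqueMDiffOn

theorem continuousOn_velocity [IsManifold (𝓡 n) ∞ M] {γ : ℝ → M} {a b : ℝ} (hab : a < b)
    (hγ : ContMDiffOn 𝓘(ℝ, ℝ) (𝓡 n) 1 γ (Icc a b)) :
    ContinuousOn (fun t => (⟨γ t, velocity (n := n) γ a b t⟩ : TangentBundle (𝓡 n) M))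
      (Icc a b) := by
  have : IsManifold (𝓡 n) 1 M := IsManifold.of_le (n := ∞) (by simp)
  have h := hγ.continuousOn_tangentMapWithin le_rfl (uniqueMDiffOn_Icc_real hab)
  have hs : Continuous (fun t : ℝ => (⟨t, (1 : ℝ)⟩ : TangentBundle 𝓘(ℝ, ℝ) ℝ)) :=
    (tangentBundleModelSpaceHomeomorph 𝓘(ℝ, ℝ)).symm.continuous.comp
      (continuous_id.prodMk continuous_const)
  exact h.comp hs.continuousOn fun t ht => ht

theorem velocity_comp {γ : ℝ → M} {φ : ℝ → ℝ} {a b c d τ r : ℝ} (hcd : c < d)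
    (hτ : τ ∈ Icc c d) (hmaps : MapsTo φ (Icc c d) (Icc a b))
    (hγ : MDifferentiableWithinAt 𝓘(ℝ, ℝ) (𝓡 n) γ (Icc a b) (φ τ))
    (hφ : HasDerivWithinAt φ r (Icc c d) τ) :
    velocity (n := n) (γ ∘ φ) c d τ = r • velocity (n := n) γ a b (φ τ) := by
  have h1 : MDifferentiableWithinAt 𝓘(ℝ, ℝ) 𝓘(ℝ, ℝ) φ (Icc c d) τ :=
    hφ.differentiableWithinAt.mdifferentiableWithinAt
  rw [velocity, mfderivWithin_comp τ hγ h1 hmaps (uniqueMDiffOn_Icc_real hcd τ hτ)]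
  have h2 : mfderivWithin 𝓘(ℝ, ℝ) 𝓘(ℝ, ℝ) φ (Icc c d) τ (1 : ℝ) = r • (1 : ℝ) := by
    rw [mfderivWithin_eq_fderivWithin]
    have := hφ.derivWithin (uniqueDiffOn_Icc hcd τ hτ)
    rw [derivWithin] at this
    rw [smul_eq_mul, mul_one]
    exact this
  have h3 := (mfderivWithin 𝓘(ℝ, ℝ) (𝓡 n) γ (Icc a b) (φ τ)).map_smul r (1 : ℝ)
  rw [velocity]
  refine Eq.trans ?_ h3
  exact congrArg (mfderivWithin 𝓘(ℝ, ℝ) (𝓡 n) γ (Icc a b) (φ τ)) h2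

end Velocity

/-! ### Arc-length reparametrization and optimality -/

section Reparametrization

variable {n : ℕ} {M : Type*} [TopologicalSpace M] [ChartedSpace (Model n) M]
  [IsManifold (𝓡 n) ∞ M]

/-- Functions on the tangent bundle that are continuous off the zero section, positive there, and
positively homogeneous. -/
structure IsContinuousNorm (N : ∀ x : M, Tan n x → ℝ) : Prop where
  continuousOn : ContinuousOn (fun p : TangentBundle (𝓡 n) M => N p.1 p.2) {p | p.2 ≠ 0}
  pos (x : M) (v : Tan n x) : v ≠ 0 → 0 < N x v
  smul (x : M) (c : ℝ) (v : Tan n x) : 0 < c → N x (c • v) = c * N x v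

theorem FinslerMetric.isContinuousNorm (F : FinslerMetric n M) : IsContinuousNorm F.toFun :=
  ⟨F.contMDiffOn.continuousOn, F.pos, fun x c v hc => F.homogeneous x c hc v⟩

/-- Reparametrizing by this norm produces trajectories before anything relates it to `F`. -/
theorem NavigationData.isContinuousNorm (D : NavigationData n M) :
    IsContinuousNorm D.randersNorm :=
  ⟨D.continuous_randersNorm.continuousOn, fun x _ => D.randersNorm_pos x,
    fun x _ v hc => D.randersNorm_smul x hc.le v⟩

variable {N : ∀ x : M, Tan n x → ℝ}

theorem IsContinuousNorm.zero (hN : IsContinuousNorm N) (x : M) : N x 0 = 0 := by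
  have := hN.smul x 2 0 two_pos
  rw [smul_zero] at this
  linarith

theorem IsContinuousNorm.ne_zero (hN : IsContinuousNorm N) {x : M} {v : Tan n x}
    (h : N x v = 1) : v ≠ 0 := by
  rintro rfl
  rw [hN.zero] at h
  exact zero_ne_one h

theorem IsContinuousNorm.continuousOn_speed (hN : IsContinuousNorm N) {γ : ℝ → M} {a b : ℝ}
    (hab : a < b) (hγ : ContMDiffOn 𝓘(ℝ, ℝ) (𝓡 n) 1 γ (Icc a b))
    (h0 : ∀ t ∈ Icc a b, velocity (n := n) γ a b t ≠ 0) :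
    ContinuousOn (fun t => N (γ t) (velocity γ a b t)) (Icc a b) :=
  hN.continuousOn.comp (continuousOn_velocity hab hγ) h0

/-- Regularity of a piecewise `C¹` path with prescribed break points. -/
def IsRegularOff (n : ℕ) {M : Type*} [TopologicalSpace M] [ChartedSpace (Model n) M]
    (γ : ℝ → M) (a b : ℝ) (S : Set ℝ) : Prop :=
  ∀ c d : ℝ, a ≤ c → c < d → d ≤ b → Disjoint (Ioo c d) S →
    ContMDiffOn 𝓘(ℝ, ℝ) (𝓡 n) 1 γ (Icc c d) ∧ ∀ t ∈ Icc c d, velocity (n := n) γ c d t ≠ 0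

theorem exists_Icc_off {S : Set ℝ} (hS : S.Finite) {a b t : ℝ} (ht : t ∈ Ioo a b) (htS : t ∉ S) :
    ∃ c d, a ≤ c ∧ t ∈ Ioo c d ∧ d ≤ b ∧ Disjoint (Ioo c d) S := by
  have h : Ioo a b ∩ Sᶜ ∈ 𝓝 t :=
    inter_mem (Ioo_mem_nhds ht.1 ht.2) (hS.isClosed.isOpen_compl.mem_nhds htS)
  obtain ⟨c, d, htcd, hcd⟩ := mem_nhds_iff_exists_Ioo_subset.mp h
  refine ⟨max a c, min b d, le_max_left _ _, ⟨max_lt ht.1 htcd.1, lt_min ht.2 htcd.2⟩,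
    min_le_left _ _, ?_⟩
  refine disjoint_left.mpr fun u hu huS => (hcd ⟨?_, ?_⟩).2 huS
  · exact (le_max_right _ _).trans_lt hu.1
  · exact hu.2.trans_le (min_le_right _ _)

/-- Reparametrization of a regular path by its length with respect to `N`. -/
theorem IsContinuousNorm.exists_reparam (hN : IsContinuousNorm N) {γ : ℝ → M} {a b : ℝ}
    (hab : a < b) {S : Set ℝ} (hS : S.Finite) (hγ : IsRegularOff n γ a b S) :
    ∃ (T : ℝ) (φ : ℝ ≃o ℝ), 0 < T ∧ φ 0 = a ∧ φ T = b ∧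
      T = ∫ t in a..b, N (γ t) (mfderiv 𝓘(ℝ, ℝ) (𝓡 n) γ t (1 : ℝ)) ∧
      ∀ c d, 0 ≤ c → c < d → d ≤ T → Disjoint (Ioo (φ c) (φ d)) S →
        ContMDiffOn 𝓘(ℝ, ℝ) (𝓡 n) 1 (γ ∘ φ) (Icc c d) ∧
        ∀ τ ∈ Icc c d, velocity (n := n) (γ ∘ φ) c d τ =
          (N (γ (φ τ)) (velocity γ (φ c) (φ d) (φ τ)))⁻¹ • velocity γ (φ c) (φ d) (φ τ) := by
  classical
  set sp : ℝ → ℝ := fun t => N (γ t) (mfderiv 𝓘(ℝ, ℝ) (𝓡 n) γ t (1 : ℝ)) with hsp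
  -- The value `1` at break points and outside `(a, b)` keeps `f` positive everywhere, so its
  -- primitive is an increasing bijection of the whole line; on `[a, b]` only finitely many values
  -- change.
  set f : ℝ → ℝ := fun t => if t ∈ Ioo a b \ S then sp t else 1 with hf
  have hf_piece {c d : ℝ} (hc : a ≤ c) (hd : d ≤ b) (hdis : Disjoint (Ioo c d) S) :
      EqOn f (fun t => N (γ t) (velocity γ c d t)) (Ioo c d) := by
    intro t ht
    have ht' : t ∈ Ioo a b \ S :=
      ⟨⟨hc.trans_lt ht.1, ht.2.trans_le hd⟩, disjoint_left.mp hdis ht⟩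
    simp only [hf, if_pos ht', hsp, velocity_eq_mfderiv γ ht]
  have hcont {c d : ℝ} (hc : a ≤ c) (hcd : c < d) (hd : d ≤ b) (hdis : Disjoint (Ioo c d) S) :
      ContinuousOn (fun t => N (γ t) (velocity γ c d t)) (Icc c d) :=
    hN.continuousOn_speed hcd (hγ c d hc hcd hd hdis).1 (hγ c d hc hcd hd hdis).2
  have hpos (t : ℝ) : 0 < f t := by
    by_cases ht : t ∈ Ioo a b \ S
    · obtain ⟨c, d, hc, htcd, hd, hdis⟩ := exists_Icc_off hS ht.1 ht.2
      rw [hf_piece hc hd hdis htcd]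
      exact hN.pos _ _ ((hγ c d hc (htcd.1.trans htcd.2) hd hdis).2 t (Ioo_subset_Icc_self htcd))
    · exact one_pos.trans_eq (if_neg ht).symm
  have hint_le {c d : ℝ} (hcd : c ≤ d) : IntervalIntegrable f volume c d := by
    -- With `a` and `b` as extra breaks, `f` is on each gap either the speed of a `C¹` piece or
    -- constantly `1`.
    refine intervalIntegrable_of_finite_breaks ((hS.insert a).insert b) hcd
      fun c d _ hcd _ hdis => ?_
    obtain ⟨hb, hdis⟩ := disjoint_insert_right.mp hdis
    obtain ⟨ha, hdis⟩ := disjoint_insert_right.mp hdis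
    by_cases hcase : a ≤ c ∧ d ≤ b
    · have h := (hcont hcase.1 hcd hcase.2 hdis).intervalIntegrable_of_Icc (μ := volume) hcd.le
      refine h.congr_uIoo ?_
      rw [uIoo_of_le hcd.le]
      exact (hf_piece hcase.1 hcase.2 hdis).symm
    · refine (intervalIntegrable_const (c := (1 : ℝ))).congr_uIoo ?_
      rw [uIoo_of_le hcd.le]
      intro t ht
      have : t ∉ Ioo a b \ S := by
        rintro ⟨ht', -⟩
        simp only [mem_Ioo, not_and, not_lt] at ha hb
        rw [not_and_or, not_le, not_le] at hcase
        rcases hcase with h | h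
        · linarith [ha h, ht.2, ht'.1]
        · have : ¬ c < b := fun h' => absurd (hb h') (not_le.mpr h)
          linarith [ht.1, ht'.2]
      exact (if_neg this).symm
  have hint (c d : ℝ) : IntervalIntegrable f volume c d :=
    (le_total c d).elim hint_le fun h => (hint_le h).symm
  set L : ℝ → ℝ := fun t => ∫ s in a..t, f s with hL
  have hLsub (c d : ℝ) : L d = L c + ∫ s in c..d, f s :=
    (intervalIntegral.integral_add_adjacent_intervals (hint a c) (hint c d)).symm
  have hLmono : StrictMono L := by
    intro c d hcd
    rw [hLsub c d]
    linarith [intervalIntegral.intervalIntegral_pos_of_pos (hint c d) hpos hcd]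
  have hLcont : Continuous L := intervalIntegral.continuous_primitive hint a
  have hLtop : Tendsto L atTop atTop := by
    -- Beyond `b` the primitive has slope one: `L t = t + (L b - b)`.
    refine (tendsto_atTop_add_const_right _ (L b - b) tendsto_id).congr' ?_
    filter_upwards [eventually_ge_atTop b] with t ht
    rw [hLsub b t, intervalIntegral.integral_congr_Ioo_of_le (g := fun _ => (1 : ℝ)) ht]
    · simp
      ring
    · intro s hs
      exact if_neg fun h => (hs.1.trans h.1.2).false
  have hLbot : Tendsto L atBot atBot := by
    refine (tendsto_atBot_add_const_right _ (L a - a) tendsto_id).congr' ?_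
    filter_upwards [eventually_le_atBot a] with t ht
    have h1 := hLsub t a
    rw [intervalIntegral.integral_congr_Ioo_of_le (g := fun _ => (1 : ℝ)) ht] at h1
    · simp at h1 ⊢
      linarith
    · intro s hs
      exact if_neg fun h => (hs.2.trans h.1.1).false
  set Φ : ℝ ≃o ℝ := hLmono.orderIsoOfSurjective L (hLcont.surjective hLtop hLbot) with hΦ
  have hLφ (τ : ℝ) : L (Φ.symm τ) = τ := Φ.apply_symm_apply τ
  have hφL (t : ℝ) : Φ.symm (L t) = t := Φ.symm_apply_apply t
  have hLa : L a = 0 := intervalIntegral.integral_same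
  refine ⟨L b, Φ.symm, hLa ▸ hLmono hab, ?_, hφL b, ?_, ?_⟩
  · rw [← hLa, hφL]
  · refine intervalIntegral.integral_congr_ae' ?_ ?_
    · filter_upwards [(hS.insert b).countable.ae_notMem volume] with t ht htab
      rw [mem_insert_iff, not_or] at ht
      exact if_pos ⟨⟨htab.1, lt_of_le_of_ne htab.2 ht.1⟩, ht.2⟩
    · exact Eventually.of_forall fun t ht => absurd (ht.1.trans_le ht.2) hab.not_gt
  · intro c d hc hcd hd hdis
    have hφc : a ≤ Φ.symm c := by
      rw [← hφL a, hLa]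
      exact Φ.symm.monotone hc
    have hφd : Φ.symm d ≤ b := by
      rw [← hφL b]
      exact Φ.symm.monotone hd
    have hφcd : Φ.symm c < Φ.symm d := Φ.symm.strictMono hcd
    have hmaps : MapsTo Φ.symm (Icc c d) (Icc (Φ.symm c) (Φ.symm d)) :=
      fun τ hτ => ⟨Φ.symm.monotone hτ.1, Φ.symm.monotone hτ.2⟩
    have hreg := hγ _ _ hφc hφcd hφd hdis
    have hg := hcont hφc hφcd hφd hdis
    have hg0 : ∀ t ∈ Icc (Φ.symm c) (Φ.symm d),
        N (γ t) (velocity γ (Φ.symm c) (Φ.symm d) t) ≠ 0 :=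
      fun t ht => (hN.pos _ _ (hreg.2 t ht)).ne'
    have hderiv : ∀ t ∈ Icc (Φ.symm c) (Φ.symm d), HasDerivWithinAt L
        (N (γ t) (velocity γ (Φ.symm c) (Φ.symm d) t)) (Icc (Φ.symm c) (Φ.symm d)) t :=
      fun t ht => hasDerivWithinAt_primitive hφcd (fun u _ => hLsub _ u) hg
        (hf_piece hφc hφd hdis) ht
    have hφcont : ContinuousOn Φ.symm (Icc c d) := Φ.symm.continuous.continuousOn
    refine ⟨hreg.1.comp (contDiffOn_of_leftInverse hcd hφcont hmaps hderiv hg0 hg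
      fun τ _ => hLφ τ).contMDiffOn hmaps, fun τ hτ => ?_⟩
    exact velocity_comp hcd hτ hmaps ((hreg.1 _ (hmaps hτ)).mdifferentiableWithinAt one_ne_zero)
      (hasDerivWithinAt_of_leftInverse hφcont hmaps hderiv hg0 (fun τ _ => hLφ τ) hτ)

theorem IsContinuousNorm.inv_smul (hN : IsContinuousNorm N) {x : M} {v : Tan n x} (hv : v ≠ 0) :
    N x ((N x v)⁻¹ • v) = 1 := by
  have h := hN.pos x v hv
  rw [hN.smul x _ v (inv_pos.mpr h), inv_mul_cancel₀ h.ne']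

/-- Every regular path can be run through with unit speed, in a time equal to its length. -/
theorem IsContinuousNorm.exists_unitSpeed (hN : IsContinuousNorm N) {γ : ℝ → M} {a b : ℝ}
    (hγ : IsRegularPath (n := n) γ a b) :
    ∃ (σ : ℝ → M) (T : ℝ), IsPathWith (n := n) σ 0 T (fun x v => N x v = 1) ∧
      σ 0 = γ a ∧ σ T = γ b ∧
      T = ∫ t in a..b, N (γ t) (mfderiv 𝓘(ℝ, ℝ) (𝓡 n) γ t (1 : ℝ)) := by
  obtain ⟨hab, hcont, S, hS, hreg⟩ := hγ
  change IsRegularOff n γ a b S at hreg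
  obtain ⟨T, φ, hT, h0, hT', hlen, hpiece⟩ := hN.exists_reparam hab hS hreg
  have hmaps : MapsTo φ (Icc 0 T) (Icc a b) :=
    fun τ hτ => ⟨h0 ▸ φ.monotone hτ.1, hT' ▸ φ.monotone hτ.2⟩
  refine ⟨γ ∘ φ, T, ⟨hT, hcont.comp φ.continuous.continuousOn hmaps, φ ⁻¹' S,
    hS.preimage φ.injective.injOn, fun c d hc hcd hd hdis => ?_⟩, by simp [h0], by simp [hT'],
    hlen⟩
  have hdis' : Disjoint (Ioo (φ c) (φ d)) S := by
    refine disjoint_left.mpr fun t ht htS => ?_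
    obtain ⟨τ, rfl⟩ := φ.surjective t
    exact disjoint_left.mp hdis ⟨φ.lt_iff_lt.mp ht.1, φ.lt_iff_lt.mp ht.2⟩ htS
  obtain ⟨h1, h2⟩ := hpiece c d hc hcd hd hdis'
  refine ⟨h1, fun τ hτ => ?_⟩
  have hac : a ≤ φ c := h0 ▸ φ.monotone hc
  have hdb : φ d ≤ b := hT' ▸ φ.monotone hd
  have hv := (hreg _ _ hac (φ.strictMono hcd) hdb hdis').2 (φ τ)
    ⟨φ.monotone hτ.1, φ.monotone hτ.2⟩
  have h3 := h2 τ hτ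
  rw [velocity] at h3
  rw [h3]
  exact hN.inv_smul hv

omit [IsManifold (𝓡 n) ∞ M] in
/-- The length of a path of unit speed is the time it takes. -/
theorem integral_speed_eq {γ : ℝ → M} {a b : ℝ}
    (hγ : IsPathWith (n := n) γ a b (fun x v => N x v = 1)) :
    ∫ t in a..b, N (γ t) (mfderiv 𝓘(ℝ, ℝ) (𝓡 n) γ t (1 : ℝ)) = b - a := by
  obtain ⟨hab, -, S, hS, hreg⟩ := hγ
  have h : ∫ t in a..b, N (γ t) (mfderiv 𝓘(ℝ, ℝ) (𝓡 n) γ t (1 : ℝ)) = ∫ _ in a..b, (1 : ℝ) := by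
    refine intervalIntegral.integral_congr_ae' ?_ ?_
    · filter_upwards [(hS.insert b).countable.ae_notMem volume] with t ht htab
      rw [mem_insert_iff, not_or] at ht
      obtain ⟨c, d, hc, htcd, hd, hdis⟩ :=
        exists_Icc_off hS ⟨htab.1, lt_of_le_of_ne htab.2 ht.1⟩ ht.2
      rw [← velocity_eq_mfderiv γ htcd]
      exact (hreg c d hc (htcd.1.trans htcd.2) hd hdis).2 t (Ioo_subset_Icc_self htcd)
    · exact Eventually.of_forall fun t ht => absurd (ht.1.trans_le ht.2) hab.not_gt
  rw [h]
  simp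

omit [IsManifold (𝓡 n) ∞ M] in
theorem IsPathWith.imp {γ : ℝ → M} {a b : ℝ} {P Q : ∀ x : M, Tan n x → Prop}
    (h : IsPathWith γ a b P) (hPQ : ∀ x v, P x v → Q x v) : IsPathWith γ a b Q := by
  obtain ⟨hab, hc, S, hS, hreg⟩ := h
  refine ⟨hab, hc, S, hS, fun c d h1 h2 h3 h4 => ?_⟩
  obtain ⟨h5, h6⟩ := hreg c d h1 h2 h3 h4
  exact ⟨h5, fun t ht => hPQ _ _ (h6 t ht)⟩

/-- A Finsler metric whose indicatrices consist of the velocities of the ship solves the navigation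
problem. -/
theorem FinslerMetric.solves_of_indicatrix {F : FinslerMetric n M} {D : NavigationData n M}
    (h : ∀ (x : M) (v : Tan n x), F.toFun x v = 1 ↔ D.IsVelocity x v) : F.Solves D := by
  have hN := F.isContinuousNorm
  have hpath (γ : ℝ → M) (T : ℝ) : D.IsTrajectory γ T ↔ F.IsUnitSpeed γ 0 T :=
    ⟨fun hγ => hγ.imp fun x v => (h x v).mpr, fun hγ => hγ.imp fun x v => (h x v).mp⟩
  have hlen {γ : ℝ → M} {T : ℝ} (hγ : F.IsUnitSpeed γ 0 T) : F.length γ 0 T = T := by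
    rw [length, integral_speed_eq hγ, sub_zero]
  have hregular {γ : ℝ → M} {T : ℝ} (hγ : F.IsUnitSpeed γ 0 T) :
      IsRegularPath (n := n) γ 0 T := hγ.imp fun x v => hN.ne_zero
  refine ⟨fun γ T hγ => hlen ((hpath γ T).mp hγ), fun γ T => ⟨?_, ?_⟩⟩
  · rintro ⟨hγ, hopt⟩
    have hγ' := (hpath γ T).mp hγ
    refine ⟨hγ', hregular hγ', fun σ c d hσ h0 h1 => ?_⟩
    -- Run at unit speed, the competitor becomes a trajectory whose transit time is its length.
    obtain ⟨ρ, T', hρ, hρ0, hρ1, hT'⟩ := hN.exists_unitSpeed hσ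
    rw [hlen hγ']
    refine (hopt ρ T' ((hpath ρ T').mpr hρ) (hρ0.trans h0) (hρ1.trans h1)).trans_eq hT'
  · rintro ⟨hγ, -, hopt⟩
    refine ⟨(hpath γ T).mpr hγ, fun σ T' hσ h0 h1 => ?_⟩
    have hσ' := (hpath σ T').mp hσ
    rw [← hlen hγ, ← hlen hσ']
    exact hopt σ 0 T' (hregular hσ') h0 h1

end Reparametrization

/-! ### Recovering `F` from transit times, and the effect of the wind -/

section Main

variable {n : ℕ} {M : Type*} [TopologicalSpace M] [ChartedSpace (Model n) M]
  [IsManifold (𝓡 n) ∞ M]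

/-- Every nonzero tangent vector is the initial velocity of a regular path. -/
theorem exists_path_of_velocity (x : M) {v : Tan n x} (hv : v ≠ 0) :
    ∃ (γ : ℝ → M) (ε : ℝ), 0 < ε ∧ IsRegularOff n γ 0 ε ∅ ∧
      (⟨γ 0, velocity γ 0 ε 0⟩ : TangentBundle (𝓡 n) M) = ⟨x, v⟩ := by
  have : IsManifold (𝓡 n) 1 M := IsManifold.of_le (n := ∞) (by simp)
  let w : Model n := v
  set e := extChartAt (𝓡 n) x with he
  -- A straight segment in the chart at `x`, where the fibre over `x` is identified with the model
  -- space.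
  let l : ℝ → Model n := fun t => e x + t • w
  have hl (t : ℝ) : HasDerivAt l w t := by
    have := ((hasDerivAt_id t).smul_const w).const_add (e x)
    rwa [one_smul] at this
  have hlc : ContDiff ℝ 1 l := contDiff_const.add (contDiff_id.smul contDiff_const)
  have hl0 : l 0 = e x := by simp [l]
  have hnhds : l ⁻¹' e.target ∈ 𝓝 (0 : ℝ) := by
    refine hlc.continuous.continuousAt.preimage_mem_nhds ?_
    rw [hl0]
    exact extChartAt_target_mem_nhds x
  obtain ⟨ε, hε, hball⟩ := Metric.nhds_basis_closedBall.mem_iff.mp hnhds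
  have htarget {t : ℝ} (h0 : 0 ≤ t) (h1 : t ≤ ε) : l t ∈ e.target := by
    apply hball
    rw [Metric.mem_closedBall, Real.dist_eq, sub_zero, abs_of_nonneg h0]
    exact h1
  have hvel {c d t : ℝ} (hc : 0 ≤ c) (hcd : c < d) (hd : d ≤ ε) (ht : t ∈ Icc c d) :
      velocity (n := n) (e.symm ∘ l) c d t =
        mfderivWithin 𝓘(ℝ, Model n) (𝓡 n) e.symm (range (𝓡 n)) (l t) w := by
    have h1 : MDifferentiableWithinAt 𝓘(ℝ, ℝ) 𝓘(ℝ, Model n) l (Icc c d) t :=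
      (hl t).hasDerivWithinAt.differentiableWithinAt.mdifferentiableWithinAt
    have h2 := mdifferentiableWithinAt_extChartAt_symm (I := 𝓡 n) (x := x)
      (htarget (hc.trans ht.1) (ht.2.trans hd))
    rw [velocity, mfderivWithin_comp t h2 h1 (by simp) (uniqueMDiffOn_Icc_real hcd t ht)]
    have h3 : mfderivWithin 𝓘(ℝ, ℝ) 𝓘(ℝ, Model n) l (Icc c d) t (1 : ℝ) = w := by
      rw [mfderivWithin_eq_fderivWithin]
      have := (hl t).hasDerivWithinAt.derivWithin (uniqueDiffOn_Icc hcd t ht)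
      rwa [derivWithin] at this
    exact congrArg (mfderivWithin 𝓘(ℝ, Model n) (𝓡 n) e.symm (range (𝓡 n)) (l t)) h3
  refine ⟨e.symm ∘ l, ε, hε, fun c d hc hcd hd _ => ⟨?_, fun t ht => ?_⟩, ?_⟩
  · refine ((contMDiffOn_extChartAt_symm (I := 𝓡 n) (n := 1) x).comp
      hlc.contMDiff.contMDiffOn fun t ht => htarget (hc.trans ht.1) (ht.2.trans hd))
  · rw [hvel hc hcd hd ht]
    obtain ⟨A, hA⟩ := isInvertible_mfderivWithin_extChartAt_symm (I := 𝓡 n) (x := x)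
      (htarget (hc.trans ht.1) (ht.2.trans hd))
    intro h0
    apply hv
    have h0' : A w = 0 := by
      rw [← ContinuousLinearEquiv.coe_coe, hA]
      exact h0
    exact A.map_eq_zero_iff.mp h0'
  · rw [hvel le_rfl hε le_rfl (left_mem_Icc.mpr hε.le)]
    have hx : (e.symm ∘ l) 0 = x := by simp [hl0, he]
    -- Equality in the total space, with a free point `z`, avoids transporting vectors between
    -- fibres. At `e x` the derivative of the inverse chart is the identity.
    have key : ∀ z, z = e x → (⟨e.symm z,
        mfderivWithin 𝓘(ℝ, Model n) (𝓡 n) e.symm (range (𝓡 n)) z w⟩ :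
          TangentBundle (𝓡 n) M) = ⟨x, v⟩ := by
      rintro z rfl
      rw [he, mfderivWithin_range_extChartAt_symm]
      have hxx := extChartAt_to_inv (I := 𝓡 n) x
      have : ∀ y : M, y = x → (⟨y, w⟩ : TangentBundle (𝓡 n) M) = ⟨x, v⟩ := by
        rintro y rfl
        rfl
      exact this _ hxx
    exact key _ hl0

/-- A Finsler metric that solves a navigation problem is the Randers norm of the data. -/
theorem FinslerMetric.Solves.eq_randersNorm {F : FinslerMetric n M} {D : NavigationData n M}
    (h : F.Solves D) (x : M) (v : Tan n x) : F.toFun x v = D.randersNorm x v := by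
  have hF := F.isContinuousNorm
  have hN := D.isContinuousNorm
  by_cases hv : v = 0
  · rw [hv, hF.zero, hN.zero]
  obtain ⟨γ, ε, hε, hγ, hγ0⟩ := exists_path_of_velocity x hv
  obtain ⟨T, φ, hT, h0, hTε, -, hpiece⟩ := hN.exists_reparam hε finite_empty hγ
  have hpiece' {c d : ℝ} (hc : 0 ≤ c) (hcd : c < d) (hd : d ≤ T) :=
    hpiece c d hc hcd hd (disjoint_empty _)
  have hone {c d τ : ℝ} (hc : 0 ≤ c) (hcd : c < d) (hd : d ≤ T) (hτ : τ ∈ Icc c d) :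
      D.randersNorm ((γ ∘ φ) τ) (velocity (γ ∘ φ) c d τ) = 1 := by
    rw [(hpiece' hc hcd hd).2 τ hτ]
    refine hN.inv_smul ((hγ _ _ ?_ (φ.strictMono hcd) ?_ (disjoint_empty _)).2 _
      ⟨φ.monotone hτ.1, φ.monotone hτ.2⟩)
    · rw [← h0]
      exact φ.monotone hc
    · rw [← hTε]
      exact φ.monotone hd
  -- Every initial segment is a trajectory, so its `F`-length is known for all small times and can
  -- be differentiated at `0`.
  have htraj {τ : ℝ} (hτ : 0 < τ) (hτT : τ ≤ T) : D.IsTrajectory (γ ∘ φ) τ := by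
    refine ⟨hτ, (hpiece' le_rfl hτ hτT).1.continuousOn, ∅, finite_empty,
      fun c d hc hcd hd _ => ⟨(hpiece' hc hcd (hd.trans hτT)).1, fun t ht => ?_⟩⟩
    exact (D.randersNorm_eq_one_iff _ _).mp (hone hc hcd (hd.trans hτT) ht)
  have hcont := hF.continuousOn_speed hT (hpiece' le_rfl hT le_rfl).1
    fun τ hτ => hN.ne_zero (hone le_rfl hT le_rfl hτ)
  have h1 := eq_one_of_integral_eq hT hcont fun τ hτ hτT => by
    refine Eq.trans ?_ (h.transit_time _ _ (htraj hτ hτT))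
    rw [FinslerMetric.length]
    refine intervalIntegral.integral_congr_Ioo_of_le (μ := volume) hτ.le fun t ht => ?_
    exact congrArg (F.toFun ((γ ∘ φ) t)) (velocity_eq_mfderiv (γ ∘ φ) ⟨ht.1, ht.2.trans_le hτT⟩)
  rw [(hpiece' le_rfl hT le_rfl).2 0 (left_mem_Icc.mpr hT.le)] at h1
  simp only [Function.comp_apply, h0, hTε] at h1
  have hγv := (hγ 0 ε le_rfl hε le_rfl (disjoint_empty _)).2 (φ 0)
    (by rw [h0]; exact left_mem_Icc.mpr hε.le)
  have hφ0 : (⟨γ (φ 0), velocity γ 0 ε (φ 0)⟩ : TangentBundle (𝓡 n) M) = ⟨x, v⟩ := by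
    rw [h0]
    exact hγ0
  have hpos := hN.pos _ _ hγv
  -- The initial velocity is `v` divided by its Randers norm; homogeneity of `F` turns `F = 1` there
  -- into equality of both norms at `v`.
  rw [hF.smul _ _ _ (inv_pos.mpr hpos), inv_mul_eq_one₀ hpos.ne'] at h1
  have key : ∀ p : TangentBundle (𝓡 n) M, p = ⟨x, v⟩ →
      D.randersNorm p.1 p.2 = F.toFun p.1 p.2 → F.toFun x v = D.randersNorm x v := by
    rintro _ rfl hp
    exact hp.symm
  exact key _ hφ0 h1

theorem FinslerMetric.Solves.isRanders {F : FinslerMetric n M} {D : NavigationData n M}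
    (h : F.Solves D) : F.IsRanders :=
  ⟨D.randersMetric, D.randersForm, D.isSmoothForm_randersForm, h.eq_randersNorm⟩

/-- Reversibility kills the one-form of the Randers norm, whose value at `W` is `-|W|²/λ`. -/
theorem FinslerMetric.Solves.wind_eq_zero_of_symm {F : FinslerMetric n M}
    {D : NavigationData n M} (h : F.Solves D)
    (hsymm : ∀ (x : M) (v : Tan n x), F.toFun x (-v) = F.toFun x v) (x : M) : D.W x = 0 := by
  by_contra hW
  have h1 := hsymm x (D.W x)
  rw [h.eq_randersNorm, h.eq_randersNorm] at h1
  simp only [NavigationData.randersNorm, hnorm, map_neg, neg_apply, neg_neg, add_right_inj,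
    NavigationData.randersForm_apply] at h1
  have h2 := mul_pos (inv_pos.mpr (D.gap_pos x)) (D.h.pos x _ hW)
  linarith

theorem FinslerMetric.Solves.eq_of_wind_eq_zero {F : FinslerMetric n M}
    {D : NavigationData n M} (h : F.Solves D) {x : M} (hW : D.W x = 0) (v : Tan n x) :
    F.toFun x v = (D.speed x)⁻¹ * hnorm D.h x v := by
  have hs := D.speed_pos x
  rw [h.eq_randersNorm, NavigationData.randersNorm, hnorm, D.randersMetric_inner_self,
    D.randersForm_apply, NavigationData.gap, hW]
  simp [hnorm, Real.sqrt_mul (inv_nonneg.mpr (sq_nonneg _)), Real.sqrt_inv, Real.sqrt_sq hs.le]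

end Main

end ZermeloNavigation

/-! ### The theorem -/

open ZermeloNavigation in
theorem mainTheorem1 {n : ℕ} [NeZero n] {M : Type*} [TopologicalSpace M]
    [ChartedSpace (EuclideanSpace ℝ (Fin n)) M] [IsManifold (𝓡 n) ∞ M]
    [T2Space M] [SecondCountableTopology M]
    (F : ZermeloNavigation.FinslerMetric n M) (hF : F.IsStronglyConvex) :
    -- `F` is of Randers type iff it solves a generalized navigation problem
    (F.IsRanders ↔ ∃ D : ZermeloNavigation.NavigationData n M, F.Solves D) ∧
    -- if `F` is of Randers type, the own speed in such a problem may be prescribed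
    (F.IsRanders → ∀ s : M → ℝ, ContMDiff (𝓡 n) 𝓘(ℝ, ℝ) ∞ s → (∀ x, 0 < s x ∧ s x ≤ 1) →
      ∃ D : ZermeloNavigation.NavigationData n M, D.speed = s ∧ F.Solves D) ∧
    -- characterizations of the Riemannian cases, for every problem that `F` solves
    (∀ D : ZermeloNavigation.NavigationData n M, F.Solves D →
      (F.IsRiemannian ↔ ∀ x, D.W x = 0) ∧
      (F.IsConformalTo D.h ↔ ∀ x, D.W x = 0) ∧
      (F.IsScalingOf D.h ↔ (∀ x, D.W x = 0) ∧ ∃ k : ℝ, ∀ x, D.speed x ^ 2 = k)) := by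
  have hspeed : F.IsRanders → ∀ s : M → ℝ, ContMDiff (𝓡 n) 𝓘(ℝ, ℝ) ∞ s →
      (∀ x, 0 < s x ∧ s x ≤ 1) →
      ∃ D : ZermeloNavigation.NavigationData n M, D.speed = s ∧ F.Solves D := by
    intro hR s hs hs'
    obtain ⟨D, hD, hFD⟩ := hR.exists_navigationData hs hs'
    exact ⟨D, hD, FinslerMetric.solves_of_indicatrix hFD⟩
  refine ⟨⟨fun hR => ?_, fun ⟨D, hD⟩ => hD.isRanders⟩, hspeed, fun D hD => ⟨⟨?_, ?_⟩, ⟨?_, ?_⟩,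
    ⟨?_, ?_⟩⟩⟩
  · obtain ⟨D, -, hD⟩ := hspeed hR (fun _ => 1) contMDiff_const fun _ => ⟨one_pos, le_rfl⟩
    exact ⟨D, hD⟩
  · rintro ⟨g, hg⟩
    exact hD.wind_eq_zero_of_symm fun x v => by simp [hg, hnorm]
  · refine fun hW => ⟨D.randersMetric, fun x v => ?_⟩
    simp [hD.eq_randersNorm, NavigationData.randersNorm, NavigationData.randersForm, hW x]
  · rintro ⟨ρ, -, -, hρ⟩
    -- Conformality controls only `F²`; nonnegativity lets reversibility pass to `F`.
    have hnonneg (x : M) (v : Tan n x) : 0 ≤ F.toFun x v := by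
      by_cases hv : v = 0
      · rw [hv, F.isContinuousNorm.zero]
      · exact (F.pos x v hv).le
    refine hD.wind_eq_zero_of_symm fun x v => ?_
    rw [← sq_eq_sq₀ (hnonneg _ _) (hnonneg _ _), hρ, hρ]
    simp
  · refine fun hW => ⟨fun x => ((D.speed x)⁻¹) ^ 2,
      (D.contMDiff_speed.inv₀ fun x => (D.speed_pos x).ne').pow 2,
      fun x => pow_pos (inv_pos.mpr (D.speed_pos x)) 2, fun x v => ?_⟩
    rw [hD.eq_of_wind_eq_zero (hW x), mul_pow, hnorm, Real.sq_sqrt (D.h.inner_self_nonneg x v)]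
  · rintro ⟨c, hc, hFc⟩
    have hW := hD.wind_eq_zero_of_symm fun x v => by simp [hFc, hnorm]
    refine ⟨hW, c⁻¹ ^ 2, fun x => ?_⟩
    -- Here `n ≥ 1` enters: a nonzero vector is needed to read off `1/|u| = c`.
    obtain ⟨v, hv⟩ : ∃ v : Tan n x, v ≠ 0 := exists_ne (0 : Model n)
    have h1 := hFc x v
    rw [hD.eq_of_wind_eq_zero (hW x), mul_left_inj' (hnorm_pos D.h x hv).ne'] at h1
    rw [← h1, inv_inv]
  · rintro ⟨hW, k, hk⟩
    -- The constant is `1/|u|` at any point; on an empty manifold any positive constant serves.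
    rcases isEmpty_or_nonempty M with hM | ⟨⟨x₀⟩⟩
    · exact ⟨1, one_pos, fun x => hM.elim x⟩
    · refine ⟨(D.speed x₀)⁻¹, inv_pos.mpr (D.speed_pos x₀), fun x v => ?_⟩
      rw [hD.eq_of_wind_eq_zero (hW x)]
      congr 2
      rw [← sq_eq_sq₀ (D.speed_pos x).le (D.speed_pos x₀).le, hk, hk]
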